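/- **Setting.** In a $T$-round game with $K$ arms, a table of gains $x_j(t)\in[0,1]$ ($1\le t\le T$, $1\le j\le K$) is drawn from a distribution $D$. In each round $t$ a forecasting strategy ALG selects, possibly at random, a set $U(t)$ of exactly $m$ arms, then observes the gains $x_j(t)$ of the selected arms $j\in U(t)$ only, and receives their sum; $G_{ALG}=\sum_{t}\sum_{j\in U(t)}x_j(t)$. Its choice in round $t$ may depend on its previous selections, on the previously observed gains and on the expert advice of the rounds up to $t$. An expert advice sequence $\boldsymbol\xi$ consists of $N\ge 1$ actual experts, giving vectors $\boldsymbol\xi^k(t)\in[0,1]^K$ with $\sum_j\xi^k_j(t)=m$, and of $N_r$ different underlying experts, which are sequences of nonnegative vectors $\boldsymbol\zeta^i(t)\in\mathbb R^K$, such that each actual expert is the sum of $m$ underlying experts: for every $k$ there is $A\subseteq\{1,\dots,N_r\}$ with $|A|=m$ and $\boldsymbol\xi^k(t)=\sum_{i\in A}\boldsymbol\zeta^i(t)$ for all $t$. Let $G_{\max}=\max_k\sum_t\boldsymbol\xi^k(t)\cdot\boldsymbol x(t)$ be the total gain of the best actual expert, and $G'_{\max}=\max_{|A|=m}\sum_{i\in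 A}\sum_t\boldsymbol\zeta^i(t)\cdot\boldsymbol x(t)$ that of the best $m$ underlying experts. **Theorem.** For every $\delta>0$ there is a constant $c>0$, depending only on $\delta$, such that the following holds for all integers $K,m,n,T,N_r$ with $1\le m\le(1-\delta)K$, $n\ge1$, $N_r=K^n$, $n\mid T$ and $mT\ge Kn$. There are a number $N$ of experts and a probability distribution $D$ of the gains on $[0,1]^{T\times K}$ such that for every forecasting strategy ALG there is an expert advice sequence $\boldsymbol\xi$ with $$\mathbb E\big[G_{\max}-G_{ALG}\big]\ \ge\ c\,\sqrt{\frac{mKT\ln N_r}{\ln K}},$$ and the same lower bound holds for $\mathbb E\big[G'_{\max}-G_{ALG}\big]$. The expectation is over the gains and the randomization of ALG. In particular $\inf_{ALG}\sup_{\boldsymbol\xi}\mathbb E[R_{ALG}(T)]\ge c\sqrt{mKT\ln N_r/\ln K}$ for the regret $R_{ALG}(T)=G_{\max}-G_{ALG}$, and likewise with $G'_{\max}$. -/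

import Mathlib

open MeasureTheory

/-- The `m`-arm selections `C([K], m)`. -/
abbrev MArm (K m : ℕ) : Type := {A : Finset (Fin K) // A.card = m}

/-- A table of arm gains: `x t i` is the gain of arm `i` in round `t`. -/
abbrev Gains (K T : ℕ) : Type := Fin T → Fin K → ℝ

/-- What is announced in one round: the advice vectors of the `N` actual experts and the
vectors of the `Nr` underlying experts. -/
abbrev RoundAdvice (K N Nr : ℕ) : Type := (Fin N → Fin K → ℝ) × (Fin Nr → Fin K → ℝ)

/-- An expert advice sequence over `T` rounds. `actual t k j` is the marginal probability that the
actual expert `k` gives to arm `j` in round `t`; `underlying t i` is the vector of the underlying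
expert `i`. The underlying experts are `Nr` different sequences of nonnegative vectors, and each
actual expert is the sum of `m` of them. -/
structure ExpertAdvice (K m T N Nr : ℕ) where
  actual : Fin T → Fin N → Fin K → ℝ
  underlying : Fin T → Fin Nr → Fin K → ℝ
  N_pos : 0 < N
  actual_nonneg : ∀ t k j, 0 ≤ actual t k j
  actual_le_one : ∀ t k j, actual t k j ≤ 1
  actual_sum : ∀ t k, ∑ j, actual t k j = m
  underlying_nonneg : ∀ t i j, 0 ≤ underlying t i j
  underlying_injective : Function.Injective fun (i : Fin Nr) (t : Fin T) => underlying t i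
  actual_eq : ∀ k, ∃ A : Finset (Fin Nr), A.card = m ∧
    ∀ t j, actual t k j = ∑ i ∈ A, underlying t i j

/-- A randomized forecasting strategy: in round `t` it sees the advice of the rounds `s ≤ t`, its
own selections in the rounds `s < t` and the gains observed in the rounds `s < t`, and chooses a
probability distribution on the `m`-arm selections. -/
abbrev Strategy (K m T N Nr : ℕ) : Type :=
  (t : Fin T) → ((s : Fin T) → s ≤ t → RoundAdvice K N Nr) →
    ((s : Fin T) → s < t → MArm K m) → ((s : Fin T) → s < t → Fin K → ℝ) → PMF (MArm K m)

/-- Semi-bandit feedback: only the gains of the selected arms are revealed. The entries of the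
other arms are replaced by `0`, which carries no information since the selection is known. -/
def observe {K m : ℕ} (U : MArm K m) (g : Fin K → ℝ) : Fin K → ℝ :=
  fun i => if i ∈ U.1 then g i else 0

/-- The probability that the strategy plays the selections `U` (over the whole game) when the
gains are `x` and the advice is `adv`: the product of the conditional probabilities. -/
noncomputable def pathProb {K m T N Nr : ℕ} (alg : Strategy K m T N Nr)
    (adv : ExpertAdvice K m T N Nr) (x : Gains K T) (U : Fin T → MArm K m) : ℝ :=
  ∏ t, (alg t (fun s _ => (adv.actual s, adv.underlying s)) (fun s _ => U s)
    (fun s _ => observe (U s) (x s)) (U t)).toReal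

/-- `G_ALG`, the total gain of the selections `U`. -/
def algGain {K m T : ℕ} (x : Gains K T) (U : Fin T → MArm K m) : ℝ :=
  ∑ t, ∑ i ∈ (U t).1, x t i

namespace ExpertAdvice

variable {K m T N Nr : ℕ}

/-- The total gain of the best actual expert. -/
noncomputable def bestExpertGain (adv : ExpertAdvice K m T N Nr) (x : Gains K T) : ℝ :=
  ⨆ k : Fin N, ∑ t, ∑ j, adv.actual t k j * x t j

/-- `G_i`, the total gain of the underlying expert `i`. -/
def underlyingGain (adv : ExpertAdvice K m T N Nr) (x : Gains K T) (i : Fin Nr) : ℝ :=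
  ∑ t, ∑ j, adv.underlying t i j * x t j

/-- The largest total gain of `m` underlying experts,
`max_{A ∈ C([Nr], m)} ∑_{i ∈ A} G_i`. -/
noncomputable def bestCombinationGain (adv : ExpertAdvice K m T N Nr) (x : Gains K T) : ℝ :=
  ⨆ A : {A : Finset (Fin Nr) // A.card = m}, ∑ i ∈ A.1, adv.underlyingGain x i

end ExpertAdvice

/-- The expected regret `E[Gmax - G_ALG]` against the benchmark `Gmax`, over the gains drawn from
`D` and the randomization of the strategy. -/
noncomputable def expectedRegret {K m T N Nr : ℕ} (D : Measure (Gains K T))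
    (alg : Strategy K m T N Nr) (adv : ExpertAdvice K m T N Nr) (Gmax : Gains K T → ℝ) : ℝ :=
  ∫ x, ∑ U : Fin T → MArm K m, pathProb alg adv x U * (Gmax x - algGain x U) ∂D

/-! Cut the `T = n * L` rounds into `n` blocks of length `L`. Each block gets its own uniformly
random hidden `m`-set; all gains are independent coins, of mean `1/2 + ε` on the hidden arms of the
current block and `1/2` elsewhere. The actual experts are all choices of one `m`-set per block, so
one of them plays the hidden sets. The underlying experts are all choices of one arm per block,
which makes `K ^ n` of them. Since the best expert gains at least as much as the hidden one, the
expected regret is at least `ε` times the expected number of hidden arms missed.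

It remains to show that a strategy selects on average hardly more than `m * m / K` hidden arms per
round (`card_mul_sum_selectProb_le`). Write the hidden set of a block as `V ∪ {i}`. If only `V` were
better, the arms outside `V` would share at most `L * m` selections in the block, so an average `i`
is rarely explored. Making `i` better then changes the law of the selections little, by a
Pinsker-type bound whose entropy term counts only selections of `i` (`abs_playExp_sub_le`,
`abs_selectProb_sub_le`). So `i` is played about as often as an average arm outside `V`; the double
count `card_mul_sum_mass_le` turns this into the bound on hidden selections.

With `ε` of order `√(K / (m * L))` the change of law stays small, and the regret is of order `n * L
* m * ε`, that is `n * √(m * K * L)`. This is the claimed rate because `ln Nr / ln K = n`. -/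

/-! ### Sequential games with partial observation and change of measure -/

section CausalGame

variable {A Y O : Type*} [Fintype A]

/-- The conditional selection probabilities of a strategy which in round `t` knows its own earlier
selections and what `obs` reveals of the earlier outcomes. -/
structure IsCausalKernel {T : ℕ} (obs : A → Y → O)
    (κ : Fin T → (Fin T → A) → (Fin T → Y) → A → ℝ) : Prop where
  nonneg : ∀ t U x a, 0 ≤ κ t U x a
  sum_one : ∀ t U x, ∑ a, κ t U x a = 1
  congr : ∀ t U U' x x', (∀ s < t, U s = U' s ∧ obs (U s) (x s) = obs (U' s) (x' s)) →
    κ t U x = κ t U' x'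

/-- The strategy for the remaining rounds, after a first round with selection `a` and
outcome `y`. -/
def tailKernel {T : ℕ} (κ : Fin (T + 1) → (Fin (T + 1) → A) → (Fin (T + 1) → Y) → A → ℝ)
    (a : A) (y : Y) : Fin T → (Fin T → A) → (Fin T → Y) → A → ℝ :=
  fun t U x => κ t.succ (Fin.cons a U) (Fin.cons y x)

theorem IsCausalKernel.tailKernel {T : ℕ} {obs : A → Y → O}
    {κ : Fin (T + 1) → (Fin (T + 1) → A) → (Fin (T + 1) → Y) → A → ℝ}
    (hκ : IsCausalKernel obs κ) (a : A) (y : Y) : IsCausalKernel obs (tailKernel κ a y) where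
  nonneg t U x b := hκ.nonneg _ _ _ _
  sum_one t U x := hκ.sum_one _ _ _
  congr t U U' x x' h := by
    refine hκ.congr _ _ _ _ _ fun s => ?_
    refine Fin.cases ?_ (fun s => ?_) s
    · simp
    · intro hs
      simpa using h s (Fin.succ_lt_succ_iff.1 hs)

theorem IsCausalKernel.tailKernel_congr {T : ℕ} {obs : A → Y → O}
    {κ : Fin (T + 1) → (Fin (T + 1) → A) → (Fin (T + 1) → Y) → A → ℝ}
    (hκ : IsCausalKernel obs κ) (a : A) {y y' : Y} (h : obs a y = obs a y') :
    _root_.tailKernel κ a y = _root_.tailKernel κ a y' := by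
  funext t U x
  refine hκ.congr _ _ _ _ _ fun s => ?_
  refine Fin.cases ?_ (fun s => ?_) s
  · simpa using h
  · simp

variable [Fintype Y]

/-- The expectation of `F` when the outcomes of the rounds are independent with weights `w` and
the selections follow `κ`. -/
def playExp {T : ℕ} (w : Fin T → Y → ℝ) (κ : Fin T → (Fin T → A) → (Fin T → Y) → A → ℝ)
    (F : (Fin T → A) → (Fin T → Y) → ℝ) : ℝ :=
  ∑ x, ∑ U, (∏ t, w t (x t)) * (∏ t, κ t U x (U t)) * F U x

theorem sum_fin_succ_pi {n : ℕ} {B : Type*} [Fintype B] (F : (Fin (n + 1) → B) → ℝ) :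
    ∑ f, F f = ∑ b, ∑ f : Fin n → B, F (Fin.cons b f) := by
  rw [← (Fin.consEquiv fun _ : Fin (n + 1) => B).sum_comp, Fintype.sum_prod_type]
  rfl

/-- The recursion behind the inductions on the number of rounds. The histories `U₀` and `x₀` are
placeholders: by causality the kernel of round `0` ignores them. -/
theorem playExp_succ {T : ℕ} {obs : A → Y → O} (w : Fin (T + 1) → Y → ℝ)
    {κ : Fin (T + 1) → (Fin (T + 1) → A) → (Fin (T + 1) → Y) → A → ℝ}
    (hκ : IsCausalKernel obs κ) (U₀ : Fin (T + 1) → A) (x₀ : Fin (T + 1) → Y)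
    (F : (Fin (T + 1) → A) → (Fin (T + 1) → Y) → ℝ) :
    playExp w κ F = ∑ y, ∑ a, w 0 y * κ 0 U₀ x₀ a *
      playExp (fun t => w t.succ) (tailKernel κ a y)
        (fun U x => F (Fin.cons a U) (Fin.cons y x)) := by
  unfold playExp
  rw [sum_fin_succ_pi]
  refine Finset.sum_congr rfl fun y _ => ?_
  simp_rw [sum_fin_succ_pi (B := A)]
  rw [Finset.sum_comm]
  refine Finset.sum_congr rfl fun a _ => ?_
  rw [Finset.mul_sum]
  refine Finset.sum_congr rfl fun x _ => ?_
  rw [Finset.mul_sum]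
  refine Finset.sum_congr rfl fun U _ => ?_
  have h0 : κ 0 (Fin.cons a U) (Fin.cons y x) = κ 0 U₀ x₀ :=
    hκ.congr _ _ _ _ _ fun s hs => absurd hs (Fin.not_lt_zero s)
  simp only [Fin.prod_univ_succ, Fin.cons_zero, Fin.cons_succ, h0, tailKernel]
  ring

section

variable {T : ℕ} (w : Fin T → Y → ℝ) (κ : Fin T → (Fin T → A) → (Fin T → Y) → A → ℝ)

theorem playExp_add (F G : (Fin T → A) → (Fin T → Y) → ℝ) :
    playExp w κ (fun U x => F U x + G U x) = playExp w κ F + playExp w κ G := by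
  simp only [playExp, mul_add, Finset.sum_add_distrib]

theorem playExp_sub (F G : (Fin T → A) → (Fin T → Y) → ℝ) :
    playExp w κ (fun U x => F U x - G U x) = playExp w κ F - playExp w κ G := by
  simp only [playExp, mul_sub, Finset.sum_sub_distrib]

theorem playExp_const_mul (c : ℝ) (F : (Fin T → A) → (Fin T → Y) → ℝ) :
    playExp w κ (fun U x => c * F U x) = c * playExp w κ F := by
  simp only [playExp, Finset.mul_sum]
  exact Finset.sum_congr rfl fun _ _ => Finset.sum_congr rfl fun _ _ => by ring

theorem playExp_sum {ι : Type*} (s : Finset ι) (F : ι → (Fin T → A) → (Fin T → Y) → ℝ) :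
    playExp w κ (fun U x => ∑ i ∈ s, F i U x) = ∑ i ∈ s, playExp w κ (F i) := by
  simp only [playExp, Finset.mul_sum]
  rw [Finset.sum_comm (s := s)]
  refine Finset.sum_congr rfl fun x _ => ?_
  rw [Finset.sum_comm]

end

theorem playExp_mono {T : ℕ} {obs : A → Y → O} {w : Fin T → Y → ℝ}
    {κ : Fin T → (Fin T → A) → (Fin T → Y) → A → ℝ}
    (hw : ∀ t y, 0 ≤ w t y) (hκ : IsCausalKernel obs κ)
    {F G : (Fin T → A) → (Fin T → Y) → ℝ} (h : ∀ U x, F U x ≤ G U x) :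
    playExp w κ F ≤ playExp w κ G := by
  unfold playExp
  refine Finset.sum_le_sum fun x _ => Finset.sum_le_sum fun U _ => ?_
  exact mul_le_mul_of_nonneg_left (h _ _) (mul_nonneg (Finset.prod_nonneg fun _ _ => hw _ _)
    (Finset.prod_nonneg fun _ _ => hκ.nonneg _ _ _ _))

variable [Nonempty A] [Nonempty Y]

theorem playExp_const {T : ℕ} {obs : A → Y → O} {w : Fin T → Y → ℝ}
    {κ : Fin T → (Fin T → A) → (Fin T → Y) → A → ℝ}
    (hw1 : ∀ t, ∑ y, w t y = 1) (hκ : IsCausalKernel obs κ) (c : ℝ) :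
    playExp w κ (fun _ _ => c) = c := by
  induction T with
  | zero => simp [playExp]
  | succ T ih =>
    rw [playExp_succ w hκ (fun _ => Classical.arbitrary A) (fun _ => Classical.arbitrary Y)]
    have h : ∀ a y, playExp (fun t => w t.succ) (tailKernel κ a y) (fun _ _ => c) = c :=
      fun a y => ih (fun t => hw1 _) (hκ.tailKernel a y)
    simp_rw [h, ← Finset.sum_mul, ← Finset.mul_sum, hκ.sum_one, mul_one, hw1, one_mul]

/-- The selection of round `t` depends only on earlier outcomes, so the outcome of round `t` is
independent of it and can be integrated out first. -/
theorem playExp_round {T : ℕ} {obs : A → Y → O} {w : Fin T → Y → ℝ}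
    {κ : Fin T → (Fin T → A) → (Fin T → Y) → A → ℝ}
    (hw1 : ∀ t, ∑ y, w t y = 1) (hκ : IsCausalKernel obs κ) (t : Fin T) (h : A → Y → ℝ) :
    playExp w κ (fun U x => h (U t) (x t)) =
      playExp w κ (fun U _ => ∑ y, w t y * h (U t) y) := by
  induction T with
  | zero => exact t.elim0
  | succ T ih =>
    rw [playExp_succ w hκ (fun _ => Classical.arbitrary A) (fun _ => Classical.arbitrary Y),
      playExp_succ w hκ (fun _ => Classical.arbitrary A) (fun _ => Classical.arbitrary Y)]
    refine Fin.cases ?_ (fun t => ?_) t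
    · simp only [Fin.cons_zero]
      simp_rw [fun a y c => playExp_const (c := c) (fun t => hw1 (Fin.succ t))
        (hκ.tailKernel a y)]
      rw [Finset.sum_comm, Finset.sum_comm (s := (Finset.univ : Finset Y))]
      refine Finset.sum_congr rfl fun a _ => ?_
      rw [← Finset.sum_mul, ← Finset.sum_mul, hw1, one_mul, Finset.mul_sum]
      exact Finset.sum_congr rfl fun y _ => by ring
    · simp only [Fin.cons_succ]
      simp_rw [fun a y => ih (fun t => hw1 (Fin.succ t)) (hκ.tailKernel a y) t]

/-- Change of measure: only the likelihood ratios of what is observed matter. -/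
theorem playExp_changeOfMeasure {T : ℕ} {obs : A → Y → O} {w w' : Fin T → Y → ℝ}
    {κ : Fin T → (Fin T → A) → (Fin T → Y) → A → ℝ} (hκ : IsCausalKernel obs κ)
    {r : Fin T → A → Y → ℝ}
    (hr : ∀ t a (g : Y → ℝ), (∀ y y', obs a y = obs a y' → g y = g y') →
      ∑ y, w' t y * g y = ∑ y, w t y * r t a y * g y)
    (f : (Fin T → A) → ℝ) :
    playExp w' κ (fun U _ => f U) =
      playExp w κ (fun U x => (∏ t, r t (U t) (x t)) * f U) := by
  induction T with
  | zero => simp [playExp]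
  | succ T ih =>
    rw [playExp_succ w' hκ (fun _ => Classical.arbitrary A) (fun _ => Classical.arbitrary Y),
      playExp_succ w hκ (fun _ => Classical.arbitrary A) (fun _ => Classical.arbitrary Y)]
    rw [Finset.sum_comm, Finset.sum_comm (s := (Finset.univ : Finset Y))]
    refine Finset.sum_congr rfl fun a _ => ?_
    simp_rw [mul_assoc]
    rw [hr 0 a]
    · refine Finset.sum_congr rfl fun y _ => ?_
      rw [ih (hκ.tailKernel a y) (fun t => hr t.succ)]
      simp only [Fin.prod_univ_succ, Fin.cons_zero, Fin.cons_succ, mul_assoc]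
      rw [playExp_const_mul]
      ring
    -- The continuation value is an admissible test function, as the remaining strategy sees `y`
    -- only through its observation.
    · intro y y' h
      rw [hκ.tailKernel_congr a h]

/-- A pointwise form of Pinsker's inequality, applied to a likelihood ratio `M = s ^ 2`: `log s ≤ s
- 1` bounds `(s - 1) ^ 2` by `M - 1 - log M`, and the weighted AM-GM inequality splits `|s - 1| * (s
+ 1)`. The free parameter `a` replaces the square root, so the bound is linear in the entropy and
can be averaged over arms directly. -/
theorem abs_sub_one_le_of_pos {M a : ℝ} (hM : 0 < M) (ha : 0 < a) :
    |M - 1| ≤ (M - 1 - Real.log M) / (2 * a) + a * (1 + M) := by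
  obtain ⟨s, hs, rfl⟩ : ∃ s : ℝ, 0 < s ∧ M = s ^ 2 :=
    ⟨√M, Real.sqrt_pos.2 hM, (Real.sq_sqrt hM.le).symm⟩
  have hlog : Real.log (s ^ 2) ≤ 2 * (s - 1) := by
    rw [Real.log_pow]
    push_cast
    linarith [Real.log_le_sub_one_of_pos hs]
  have h1 : (s - 1) ^ 2 / (2 * a) ≤ (s ^ 2 - 1 - Real.log (s ^ 2)) / (2 * a) := by
    gcongr
    nlinarith
  have h2 : a * (s + 1) ^ 2 / 2 ≤ a * (1 + s ^ 2) := by nlinarith [sq_nonneg (s - 1)]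
  have h3 : |s ^ 2 - 1| ≤ (s - 1) ^ 2 / (2 * a) + a * (s + 1) ^ 2 / 2 := by
    have : s ^ 2 - 1 = (s - 1) * (s + 1) := by ring
    rw [this, abs_mul, abs_of_pos (by linarith : 0 < s + 1), ← sq_abs (s - 1)]
    have : |s - 1| ^ 2 / (2 * a) + a * (s + 1) ^ 2 / 2 - |s - 1| * (s + 1)
        = (|s - 1| - a * (s + 1)) ^ 2 / (2 * a) := by
      field_simp
      ring
    have h4 : 0 ≤ (|s - 1| - a * (s + 1)) ^ 2 / (2 * a) := by positivity
    linarith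
  linarith

/-- The effect of changing the outcome distribution on the expectation of a bounded function of
the selections, in terms of the relative entropy of the observations. -/
theorem abs_playExp_sub_le {T : ℕ} {obs : A → Y → O} {w w' : Fin T → Y → ℝ}
    {κ : Fin T → (Fin T → A) → (Fin T → Y) → A → ℝ}
    (hw : ∀ t y, 0 ≤ w t y) (hw1 : ∀ t, ∑ y, w t y = 1) (hw1' : ∀ t, ∑ y, w' t y = 1)
    (hκ : IsCausalKernel obs κ) {r : Fin T → A → Y → ℝ} (hr0 : ∀ t a y, 0 < r t a y)
    (hr : ∀ t a (g : Y → ℝ), (∀ y y', obs a y = obs a y' → g y = g y') →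
      ∑ y, w' t y * g y = ∑ y, w t y * r t a y * g y)
    {f : (Fin T → A) → ℝ} (hf : ∀ U, |f U| ≤ 1) {a : ℝ} (ha : 0 < a) :
    |playExp w' κ (fun U _ => f U) - playExp w κ (fun U _ => f U)| ≤
      (∑ t, playExp w κ (fun U _ => ∑ y, w t y * -Real.log (r t (U t) y))) / (2 * a)
        + 2 * a := by
  -- The likelihood ratio has mean `1`; this cancels `M - 1` in the bound and leaves entropy plus `2
  -- * a`.
  have hmass := playExp_changeOfMeasure hκ hr (fun _ => 1)
  rw [playExp_const hw1' hκ] at hmass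
  have hkl : playExp w κ (fun U x => -Real.log (∏ t, r t (U t) (x t))) =
      ∑ t, playExp w κ (fun U _ => ∑ y, w t y * -Real.log (r t (U t) y)) := by
    simp_rw [fun t => (playExp_round hw1 hκ t (fun a y => -Real.log (r t a y))).symm]
    rw [← playExp_sum]
    congr 1
    funext U x
    rw [Real.log_prod (fun t _ => (hr0 _ _ _).ne'), Finset.sum_neg_distrib]
  rw [playExp_changeOfMeasure hκ hr f, ← playExp_sub]
  set B : (Fin T → A) → (Fin T → Y) → ℝ := fun U x => (1 / (2 * a)) *
      ((∏ t, r t (U t) (x t)) * 1 - 1 + -Real.log (∏ t, r t (U t) (x t)))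
      + a * (1 + (∏ t, r t (U t) (x t)) * 1) with hB
  have hBexp : playExp w κ B =
      (∑ t, playExp w κ (fun U _ => ∑ y, w t y * -Real.log (r t (U t) y))) / (2 * a)
        + 2 * a := by
    rw [hB, playExp_add, playExp_const_mul, playExp_add, playExp_sub, playExp_const_mul,
      playExp_add, hkl, ← hmass, playExp_const hw1 hκ]
    ring
  have hpt : ∀ U x, |(∏ t, r t (U t) (x t)) * f U - f U| ≤ B U x := by
    intro U x
    have hM : 0 < ∏ t, r t (U t) (x t) := Finset.prod_pos fun t _ => hr0 _ _ _
    have h1 := abs_sub_one_le_of_pos hM ha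
    have h2 : |(∏ t, r t (U t) (x t)) * f U - f U| ≤ |∏ t, r t (U t) (x t) - 1| := by
      rw [← sub_one_mul, abs_mul]
      exact mul_le_of_le_one_right (abs_nonneg _) (hf U)
    refine h2.trans (h1.trans (le_of_eq ?_))
    simp only [hB]
    ring
  rw [← hBexp, abs_le]
  constructor
  · have := playExp_mono hw hκ (F := fun U x => -1 * B U x)
      (G := fun U x => (∏ t, r t (U t) (x t)) * f U - f U)
      (fun U x => by linarith [(abs_le.1 (hpt U x)).1])
    rw [playExp_const_mul] at this
    linarith
  · exact playExp_mono hw hκ fun U x => (abs_le.1 (hpt U x)).2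

end CausalGame

/-! ### Rows of independent coins -/

section Bernoulli

variable {K : ℕ}

/-- The probability of the outcome `b` of a coin with success probability `θ`. -/
def bern (θ : ℝ) (b : Bool) : ℝ := if b then θ else 1 - θ

/-- The probability of the row `y` of independent coins with success probabilities `p`. -/
def rowWeight (p : Fin K → ℝ) (y : Fin K → Bool) : ℝ := ∏ j, bern (p j) (y j)

/-- The arm gains given by a row of coins. -/
def coinGain (y : Fin K → Bool) : Fin K → ℝ := fun j => if y j then 1 else 0

/-- Success probability `1 / 2 + ε` on the arms in `S` and `1 / 2` on the others. -/
noncomputable def hiddenMean (ε : ℝ) (S : Finset (Fin K)) (j : Fin K) : ℝ :=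
  if j ∈ S then 1 / 2 + ε else 1 / 2

theorem bern_nonneg {θ : ℝ} (h0 : 0 ≤ θ) (h1 : θ ≤ 1) (b : Bool) : 0 ≤ bern θ b := by
  cases b <;> simp [bern] <;> linarith

theorem sum_bern (θ : ℝ) : ∑ b, bern θ b = 1 := by simp [bern]

theorem sum_rowWeight_mul_coord (p : Fin K → ℝ) (i : Fin K) (φ : Bool → ℝ) :
    ∑ y, rowWeight p y * φ (y i) = ∑ b, bern (p i) b * φ b := by
  have h1 : ∀ y, rowWeight p y * φ (y i) =
      ∏ j, (bern (p j) (y j) * if j = i then φ (y j) else 1) := by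
    intro y
    rw [Finset.prod_mul_distrib, Finset.prod_ite_eq' Finset.univ i (fun j => φ (y j))]
    simp [rowWeight]
  simp_rw [h1]
  have h2 := Finset.prod_univ_sum (fun _ : Fin K => (Finset.univ : Finset Bool))
    (fun j b => bern (p j) b * if j = i then φ b else 1)
  rw [Fintype.piFinset_univ] at h2
  rw [← h2, Finset.prod_eq_single i]
  · simp
  · intro j _ hj
    simpa [hj] using sum_bern (p j)
  · simp

theorem sum_rowWeight (p : Fin K → ℝ) : ∑ y, rowWeight p y = 1 := by
  have h2 := Finset.prod_univ_sum (fun _ : Fin K => (Finset.univ : Finset Bool))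
    (fun j b => bern (p j) b)
  rw [Fintype.piFinset_univ] at h2
  simp only [rowWeight]
  rw [← h2]
  exact Finset.prod_eq_one fun j _ => sum_bern (p j)

theorem rowWeight_nonneg {p : Fin K → ℝ} (h0 : ∀ j, 0 ≤ p j) (h1 : ∀ j, p j ≤ 1)
    (y : Fin K → Bool) : 0 ≤ rowWeight p y :=
  Finset.prod_nonneg fun j _ => bern_nonneg (h0 j) (h1 j) _

theorem sum_rowWeight_mul_coinGain (p : Fin K → ℝ) (j : Fin K) :
    ∑ y, rowWeight p y * coinGain y j = p j := by
  have := sum_rowWeight_mul_coord p j (fun b => if b then 1 else 0)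
  simpa [coinGain, bern] using this

theorem rowWeight_eq_mul_erase (p : Fin K → ℝ) (i : Fin K) (y : Fin K → Bool) :
    rowWeight p y = bern (p i) (y i) * ∏ j ∈ Finset.univ.erase i, bern (p j) (y j) :=
  (Finset.mul_prod_erase _ _ (Finset.mem_univ i)).symm

theorem rowWeight_update (p : Fin K → ℝ) (i : Fin K) (θ : ℝ) (y : Fin K → Bool) :
    rowWeight (Function.update p i θ) y =
      bern θ (y i) * ∏ j ∈ Finset.univ.erase i, bern (p j) (y j) := by
  rw [rowWeight_eq_mul_erase _ i, Function.update_self]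
  congr 1
  refine Finset.prod_congr rfl fun j hj => ?_
  rw [Function.update_of_ne (Finset.ne_of_mem_erase hj)]

/-- Rows differing only in coin `i` have the same `g`, and their joint weight does not depend on the
bias of that coin; so the differences cancel in pairs. It is used when arm `i` is not selected. -/
theorem sum_rowWeight_update_mul (p : Fin K → ℝ) (i : Fin K) (θ : ℝ) {g : (Fin K → Bool) → ℝ}
    (hg : ∀ y b, g (Function.update y i b) = g y) :
    ∑ y, rowWeight (Function.update p i θ) y * g y = ∑ y, rowWeight p y * g y := by
  rw [← sub_eq_zero, ← Finset.sum_sub_distrib]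
  refine Finset.sum_involution (fun y _ => Function.update y i (!y i)) ?_ ?_ ?_ ?_
  · intro y _
    have hprod : ∏ j ∈ Finset.univ.erase i, bern (p j) (Function.update y i (!y i) j) =
        ∏ j ∈ Finset.univ.erase i, bern (p j) (y j) :=
      Finset.prod_congr rfl fun j hj => by
        rw [Function.update_of_ne (Finset.ne_of_mem_erase hj)]
    simp only [hg, rowWeight_update, rowWeight_eq_mul_erase p i, hprod, Function.update_self]
    cases y i <;> simp [bern] <;> ring
  · intro y _ _ h
    have := congrFun h i
    simp at this
  · simp
  · intro y _
    simp

theorem hiddenMean_insert (ε : ℝ) (V : Finset (Fin K)) (i : Fin K) :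
    hiddenMean ε (insert i V) = Function.update (hiddenMean ε V) i (1 / 2 + ε) := by
  funext j
  by_cases h : j = i
  · subst h
    simp [hiddenMean]
  · simp [hiddenMean, h]

theorem hiddenMean_nonneg {ε : ℝ} (hε : 0 ≤ ε) (S : Finset (Fin K)) (j : Fin K) :
    0 ≤ hiddenMean ε S j := by
  unfold hiddenMean
  split_ifs <;> linarith

theorem hiddenMean_le_one {ε : ℝ} (hε : ε ≤ 1 / 4) (S : Finset (Fin K))
    (j : Fin K) : hiddenMean ε S j ≤ 1 := by
  unfold hiddenMean
  split_ifs <;> linarith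

/-- The left side is twice the relative entropy of a fair coin with respect to one of bias `ε`;
apply `log z ≥ 1 - 1 / z` at `z = 1 - 4 * ε ^ 2`. -/
theorem coin_relativeEntropy_le {ε : ℝ} (h0 : 0 ≤ ε) (hε : ε ≤ 1 / 4) :
    -Real.log (1 + 2 * ε) + -Real.log (1 - 2 * ε) ≤ 8 * ε ^ 2 := by
  have h1 : 0 < 1 + 2 * ε := by linarith
  have h2 : 0 < 1 - 2 * ε := by linarith
  have h3 : 4 * ε ^ 2 ≤ 1 / 4 := by nlinarith
  have h4 := Real.one_sub_inv_le_log_of_pos (mul_pos h1 h2)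
  rw [Real.log_mul h1.ne' h2.ne'] at h4
  have h5 : ((1 + 2 * ε) * (1 - 2 * ε))⁻¹ ≤ 1 + 8 * ε ^ 2 := by
    rw [inv_le_iff_one_le_mul₀ (mul_pos h1 h2)]
    nlinarith [sq_nonneg ε]
  linarith

end Bernoulli

/-! ### Selection probabilities when some arms are better -/

section HiddenArms

variable {K m T : ℕ}

/-- What a strategy sees of a row of coins. -/
def observeCoins (U : MArm K m) (y : Fin K → Bool) : Fin K → ℝ := observe U (coinGain y)

theorem observeCoins_update {U : MArm K m} {i : Fin K} (hi : i ∉ U.1) (y : Fin K → Bool)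
    (b : Bool) : observeCoins U (Function.update y i b) = observeCoins U y := by
  funext j
  by_cases hj : j ∈ U.1
  · have : j ≠ i := fun h => hi (h ▸ hj)
    simp [observeCoins, observe, coinGain, this]
  · simp [observeCoins, observe, hj]

/-- The row weights when the arms in `H t` are better in round `t`. -/
noncomputable def hiddenWeight (ε : ℝ) (H : Fin T → Finset (Fin K)) (t : Fin T) :
    (Fin K → Bool) → ℝ := rowWeight (hiddenMean ε (H t))

variable (κ : Fin T → (Fin T → MArm K m) → (Fin T → Fin K → Bool) → MArm K m → ℝ)

/-- The probability that the arm `j` is selected in round `t`. -/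
noncomputable def selectProb (ε : ℝ) (H : Fin T → Finset (Fin K)) (t : Fin T) (j : Fin K) : ℝ :=
  playExp (hiddenWeight ε H) κ (fun U _ => if j ∈ (U t).1 then 1 else 0)

variable {κ}

theorem hiddenWeight_nonneg {ε : ℝ} (h0 : 0 ≤ ε) (hε : ε ≤ 1 / 4) (H : Fin T → Finset (Fin K))
    (t : Fin T) (y : Fin K → Bool) : 0 ≤ hiddenWeight ε H t y :=
  rowWeight_nonneg (hiddenMean_nonneg h0 _) (hiddenMean_le_one hε _) _

theorem sum_hiddenWeight (ε : ℝ) (H : Fin T → Finset (Fin K)) (t : Fin T) :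
    ∑ y, hiddenWeight ε H t y = 1 := sum_rowWeight _

theorem sum_selectProb [Nonempty (MArm K m)] (hκ : IsCausalKernel observeCoins κ) (ε : ℝ)
    (H : Fin T → Finset (Fin K)) (t : Fin T) : ∑ j, selectProb κ ε H t j = m := by
  unfold selectProb
  rw [← playExp_sum]
  have : (fun (U : Fin T → MArm K m) (_ : Fin T → Fin K → Bool) =>
      ∑ j, if j ∈ (U t).1 then (1 : ℝ) else 0) = fun _ _ => (m : ℝ) := by
    funext U _
    simp [(U t).2]
  rw [this, playExp_const (sum_hiddenWeight ε H) hκ]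

/-- Making the arm `i` better in the rounds of `B` changes selection probabilities only as far as
the arm `i` is explored in these rounds. -/
theorem abs_selectProb_sub_le [Nonempty (MArm K m)] (hκ : IsCausalKernel observeCoins κ) {ε : ℝ}
    (h0 : 0 ≤ ε) (hε : ε ≤ 1 / 4) {H H' : Fin T → Finset (Fin K)} {B : Finset (Fin T)}
    {i : Fin K} (hi : ∀ t ∈ B, i ∉ H t) (hH : ∀ t ∈ B, H' t = insert i (H t))
    (hH' : ∀ t ∉ B, H' t = H t) {a : ℝ} (ha : 0 < a) (t : Fin T) (j : Fin K) :
    |selectProb κ ε H' t j - selectProb κ ε H t j| ≤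
      2 * ε ^ 2 / a * ∑ s ∈ B, selectProb κ ε H s i + 2 * a := by
  -- The likelihood ratio of the observation: `(1/2 ± ε) / (1/2)` when coin `i` is seen in a round
  -- of `B`, and `1` otherwise.
  set r : Fin T → MArm K m → (Fin K → Bool) → ℝ := fun t U y =>
    if t ∈ B ∧ i ∈ U.1 then (if y i then 1 + 2 * ε else 1 - 2 * ε) else 1 with hr
  have hr0 : ∀ t U y, 0 < r t U y := by
    intro t U y
    simp only [hr]
    split_ifs <;> linarith
  have key := abs_playExp_sub_le (hiddenWeight_nonneg h0 hε H) (sum_hiddenWeight ε H)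
    (sum_hiddenWeight ε H') hκ hr0 ?_ (f := fun U => if j ∈ (U t).1 then 1 else 0) ?_ ha
  · refine key.trans ?_
    have hkl : (∑ s, playExp (hiddenWeight ε H) κ
        fun U _ => ∑ y, hiddenWeight ε H s y * -Real.log (r s (U s) y)) ≤
        4 * ε ^ 2 * ∑ s ∈ B, selectProb κ ε H s i := by
      rw [Finset.mul_sum, ← Finset.sum_filter_add_sum_filter_not Finset.univ (· ∈ B)]
      have hz : ∑ s with s ∉ B, playExp (hiddenWeight ε H) κ
          (fun U _ => ∑ y, hiddenWeight ε H s y * -Real.log (r s (U s) y)) = 0 := by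
        refine Finset.sum_eq_zero fun s hs => ?_
        have hs' : s ∉ B := by simpa using hs
        simp [hr, hs', playExp]
      rw [hz, add_zero, Finset.filter_mem_eq_inter, Finset.univ_inter]
      refine Finset.sum_le_sum fun s hs => ?_
      unfold selectProb
      rw [← playExp_const_mul]
      refine playExp_mono (hiddenWeight_nonneg h0 hε H) hκ fun U _ => ?_
      by_cases hU : i ∈ (U s).1
      · simp only [hr, hs, hU, and_self, if_true]
        have := sum_rowWeight_mul_coord (hiddenMean ε (H s)) i
          (fun b => -Real.log (if b then 1 + 2 * ε else 1 - 2 * ε))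
        rw [hiddenWeight, this]
        have hm : hiddenMean ε (H s) i = 1 / 2 := by simp [hiddenMean, hi s hs]
        have := coin_relativeEntropy_le h0 hε
        simp only [hm, bern, Fintype.sum_bool, if_true, Bool.false_eq_true, if_false]
        linarith
      · simp [hr, hU]
    have h2a : (0 : ℝ) < 2 * a := by linarith
    have := div_le_div_of_nonneg_right hkl h2a.le
    have h3 : 4 * ε ^ 2 * (∑ s ∈ B, selectProb κ ε H s i) / (2 * a) =
        2 * ε ^ 2 / a * ∑ s ∈ B, selectProb κ ε H s i := by
      field_simp
      ring
    linarith
  · intro s U g hg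
    by_cases hs : s ∈ B
    · rw [hiddenWeight, hH s hs, hiddenMean_insert]
      by_cases hU : i ∈ U.1
      · refine Finset.sum_congr rfl fun y _ => ?_
        have hm : hiddenMean ε (H s) i = 1 / 2 := by simp [hiddenMean, hi s hs]
        rw [rowWeight_update, hiddenWeight, rowWeight_eq_mul_erase _ i, hm]
        simp only [hr, hs, hU, and_self, if_true, bern]
        cases y i <;> simp only [Bool.false_eq_true, if_true, if_false] <;> ring
      · rw [sum_rowWeight_update_mul]
        · simp [hr, hU, hiddenWeight]
        · exact fun y b => hg _ _ (observeCoins_update hU y b)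
    · simp [hiddenWeight, hH' s hs, hr, hs]
  · intro U
    split_ifs <;> simp

/-- The expected regret against the hidden arms. -/
theorem playExp_hiddenGain_sub_algGain [Nonempty (MArm K m)]
    (hκ : IsCausalKernel observeCoins κ) (ε : ℝ) (H : Fin T → Finset (Fin K))
    (hcard : ∀ t, (H t).card = m) :
    playExp (hiddenWeight ε H) κ (fun U x =>
        (∑ t, ∑ j ∈ H t, coinGain (x t) j) - algGain (fun t => coinGain (x t)) U) =
      ∑ t, ε * (m - ∑ j ∈ H t, selectProb κ ε H t j) := by
  simp only [algGain, ← Finset.sum_sub_distrib]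
  rw [playExp_sum]
  refine Finset.sum_congr rfl fun t _ => ?_
  rw [playExp_round (sum_hiddenWeight ε H) hκ t
    (fun a y => (∑ j ∈ H t, coinGain y j) - ∑ j ∈ a.1, coinGain y j)]
  have hsum : ∀ S : Finset (Fin K), ∑ y, hiddenWeight ε H t y * ∑ j ∈ S, coinGain y j =
      ∑ j ∈ S, hiddenMean ε (H t) j := by
    intro S
    simp_rw [Finset.mul_sum]
    rw [Finset.sum_comm]
    exact Finset.sum_congr rfl fun j _ => sum_rowWeight_mul_coinGain _ j
  have hmean : ∀ S : Finset (Fin K), S.card = m → ∑ j ∈ S, hiddenMean ε (H t) j =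
      m / 2 + ε * ∑ j ∈ H t, if j ∈ S then 1 else 0 := by
    intro S hS
    have : ∀ j, hiddenMean ε (H t) j = 1 / 2 + if j ∈ H t then ε else 0 := by
      intro j
      unfold hiddenMean
      split_ifs <;> simp
    simp_rw [this, Finset.sum_add_distrib, Finset.sum_ite_mem, Finset.sum_const, hS,
      Finset.inter_comm S]
    simp
    ring
  have hfun : (fun (U : Fin T → MArm K m) (_ : Fin T → Fin K → Bool) =>
      ∑ y, hiddenWeight ε H t y * ((∑ j ∈ H t, coinGain y j) - ∑ j ∈ (U t).1, coinGain y j)) =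
      fun U _ => ε * m - ε * ∑ j ∈ H t, if j ∈ (U t).1 then 1 else 0 := by
    funext U _
    simp_rw [mul_sub, Finset.sum_sub_distrib, hsum]
    rw [hmean _ (hcard t), hmean _ (U t).2]
    have : (∑ j ∈ H t, if j ∈ H t then (1 : ℝ) else 0) = m := by
      rw [Finset.sum_ite_mem, Finset.inter_self, Finset.sum_const, hcard]
      simp
    rw [this]
    ring
  rw [hfun, playExp_sub, playExp_const (sum_hiddenWeight ε H) hκ, playExp_const_mul,
    playExp_sum]
  simp only [selectProb]
  ring

end HiddenArms

/-! ### Averaging over all sets of a given size -/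

section Swap

variable {α : Type*} [Fintype α] [DecidableEq α]

/-- Marking an element of an `(m + 1)`-set amounts to adding a new element to an `m`-set. -/
theorem sum_powersetCard_succ_marked (m : ℕ) (F : Finset α → α → ℝ) :
    ∑ S ∈ Finset.powersetCard (m + 1) Finset.univ, ∑ i ∈ S, F S i =
      ∑ V ∈ Finset.powersetCard m Finset.univ, ∑ i ∈ Vᶜ, F (insert i V) i := by
  rw [Finset.sum_sigma', Finset.sum_sigma']
  refine Finset.sum_bij' (fun p _ => ⟨p.1.erase p.2, p.2⟩) (fun p _ => ⟨insert p.2 p.1, p.2⟩)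
    ?_ ?_ ?_ ?_ ?_
  · rintro ⟨S, i⟩ h
    simp only [Finset.mem_sigma, Finset.mem_powersetCard_univ] at h ⊢
    simp [Finset.card_erase_of_mem h.2, h.1]
  · rintro ⟨V, i⟩ h
    simp only [Finset.mem_sigma, Finset.mem_powersetCard_univ, Finset.mem_compl] at h ⊢
    simp [Finset.card_insert_of_notMem h.2, h.1]
  · rintro ⟨S, i⟩ h
    simp only [Finset.mem_sigma] at h
    simp [Finset.insert_erase h.2]
  · rintro ⟨V, i⟩ h
    simp only [Finset.mem_sigma, Finset.mem_compl] at h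
    simp [Finset.erase_insert h.2]
  · rintro ⟨S, i⟩ h
    simp only [Finset.mem_sigma] at h
    simp [Finset.insert_erase h.2]

/-- If `e S` has total mass `m` and hardly changes when an average element is added to `S`, then
on average over the `m`-sets `S` it puts little more than the fraction `m / |α|` of its mass
on `S`. -/
theorem card_mul_sum_mass_le (m : ℕ) {e : Finset α → α → ℝ} {τ : Finset α → α → ℝ} {η : ℝ}
    (he : ∀ S, ∑ j, e S j = (m + 1 : ℕ))
    (hτ : ∀ V : Finset α, V.card = m → ∀ i ∉ V, ∀ j, |e (insert i V) j - e V j| ≤ τ V i)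
    (hη : ∀ V : Finset α, V.card = m → ∑ i ∈ Vᶜ, τ V i ≤ (Vᶜ.card : ℝ) * η) (hm : 0 ≤ η) :
    Fintype.card α * ∑ S ∈ Finset.powersetCard (m + 1) Finset.univ, ∑ i ∈ S, e S i ≤
      (Finset.powersetCard (m + 1) (Finset.univ : Finset α)).card *
        ((m + 1 : ℕ) ^ 2 + 2 * (m + 1 : ℕ) * Fintype.card α * η) := by
  -- The marked element `i` is compared with every element outside `V = S \ {i}`, itself included;
  -- this complement is `insert i Sᶜ`.
  have h1 : ∀ S ∈ Finset.powersetCard (m + 1) (Finset.univ : Finset α),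
      ∑ i ∈ S, ∑ j ∈ insert i Sᶜ, (e S i - e S j) =
        Fintype.card α * ∑ i ∈ S, e S i - (m + 1 : ℕ) ^ 2 := by
    intro S hS
    rw [Finset.mem_powersetCard_univ] at hS
    have hc : ((Sᶜ).card : ℝ) = Fintype.card α - (m + 1 : ℕ) := by
      rw [Finset.card_compl, hS, Nat.cast_sub (hS ▸ Finset.card_le_univ S)]
    have hs : ∑ j ∈ Sᶜ, e S j = (m + 1 : ℕ) - ∑ j ∈ S, e S j := by
      rw [← he S, ← Finset.sum_add_sum_compl S]
      ring
    have : ∀ i ∈ S, ∑ j ∈ insert i Sᶜ, (e S i - e S j) =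
        (Fintype.card α - (m + 1 : ℕ)) * e S i - ((m + 1 : ℕ) - ∑ j ∈ S, e S j) := by
      intro i hi
      rw [Finset.sum_insert (by simpa using hi), Finset.sum_sub_distrib, hs, Finset.sum_const,
        nsmul_eq_mul, hc]
      ring
    rw [Finset.sum_congr rfl this, Finset.sum_sub_distrib, ← Finset.mul_sum, Finset.sum_const,
      hS, nsmul_eq_mul]
    ring
  have h2 := sum_powersetCard_succ_marked m
    (fun S i => ∑ j ∈ insert i (Sᶜ : Finset α), (e S i - e S j))
  rw [Finset.sum_congr rfl h1, Finset.sum_sub_distrib, ← Finset.mul_sum, Finset.sum_const,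
    nsmul_eq_mul] at h2
  have h3 : ∀ V ∈ Finset.powersetCard m (Finset.univ : Finset α),
      ∑ i ∈ Vᶜ, ∑ j ∈ insert i (insert i V)ᶜ, (e (insert i V) i - e (insert i V) j) ≤
        ∑ i ∈ Vᶜ, 2 * Fintype.card α * η := by
    intro V hV
    rw [Finset.mem_powersetCard_univ] at hV
    have hset : ∀ i ∈ Vᶜ, insert i (insert i V)ᶜ = Vᶜ := by
      intro i hi
      rw [Finset.mem_compl] at hi
      ext j
      by_cases h : j = i
      · simp [h, hi]
      · simp [h]
    calc ∑ i ∈ Vᶜ, ∑ j ∈ insert i (insert i V)ᶜ, (e (insert i V) i - e (insert i V) j)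
        = ∑ i ∈ Vᶜ, ∑ j ∈ Vᶜ, (e (insert i V) i - e (insert i V) j) :=
          Finset.sum_congr rfl fun i hi => by rw [hset i hi]
      _ ≤ ∑ i ∈ Vᶜ, ∑ j ∈ Vᶜ, (e V i - e V j + 2 * τ V i) := by
          refine Finset.sum_le_sum fun i hi => Finset.sum_le_sum fun j _ => ?_
          have hi' : i ∉ V := Finset.mem_compl.1 hi
          have a1 := (abs_le.1 (hτ V hV i hi' i)).2
          have a2 := (abs_le.1 (hτ V hV i hi' j)).1
          linarith
      -- With `e V` in place of `e (insert i V)` the double sum is antisymmetric in `i` and `j` and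
      -- vanishes; only the error terms remain.
      _ = 2 * (Vᶜ.card : ℝ) * ∑ i ∈ Vᶜ, τ V i := by
          simp only [Finset.sum_add_distrib, Finset.sum_sub_distrib, Finset.sum_const,
            nsmul_eq_mul, ← Finset.mul_sum]
          ring
      _ ≤ 2 * (Vᶜ.card : ℝ) * (Vᶜ.card * η) := by gcongr; exact hη V hV
      _ ≤ 2 * (Vᶜ.card : ℝ) * (Fintype.card α * η) := by
          gcongr
          exact Finset.card_le_univ _
      _ = ∑ i ∈ Vᶜ, 2 * Fintype.card α * η := by
          rw [Finset.sum_const, nsmul_eq_mul]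
          ring
  -- The same bijection with a constant summand converts the count of pairs `(V, i)` back into a
  -- count of `(m + 1)`-sets.
  have h4 := sum_powersetCard_succ_marked (α := α) m (fun _ _ => 2 * Fintype.card α * η)
  have h5 : ∑ S ∈ Finset.powersetCard (m + 1) (Finset.univ : Finset α),
      ∑ _i ∈ S, 2 * Fintype.card α * η =
      (Finset.powersetCard (m + 1) (Finset.univ : Finset α)).card *
        (2 * (m + 1 : ℕ) * Fintype.card α * η) := by
    rw [← nsmul_eq_mul, ← Finset.sum_const]
    refine Finset.sum_congr rfl fun S hS => ?_
    rw [Finset.mem_powersetCard_univ] at hS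
    rw [Finset.sum_const, hS, nsmul_eq_mul]
    ring
  have h6 := Finset.sum_le_sum h3
  linarith

end Swap

/-! ### Independent hidden sets in the blocks -/

section Blocks

/-- Exchanging `σ b` with `a` is an involution on pairs; probabilistically, resampling one
coordinate preserves the uniform law. -/
theorem sum_update {ι A : Type*} [Fintype ι] [DecidableEq ι] [Fintype A] (b : ι)
    (f : (ι → A) → ℝ) :
    ∑ σ, ∑ a, f (Function.update σ b a) = Fintype.card A * ∑ σ, f σ := by
  have hinv : Function.Involutive
      (fun p : (ι → A) × A => (Function.update p.1 b p.2, p.1 b)) := by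
    rintro ⟨σ, a⟩
    simp
  have h := Equiv.sum_comp hinv.toPerm (fun p : (ι → A) × A => f p.1)
  simp only [Function.Involutive.coe_toPerm, Fintype.sum_prod_type] at h
  rw [h, Finset.mul_sum]
  exact Finset.sum_congr rfl fun σ _ => by simp

variable {K m n T : ℕ}

theorem sum_mArm (F : Finset (Fin K) → ℝ) :
    ∑ S : MArm K m, F S.1 = ∑ S ∈ Finset.powersetCard m Finset.univ, F S :=
  (Finset.sum_subtype _ (fun S => by simp) F).symm

theorem card_mArm :
    Fintype.card (MArm K m) = (Finset.powersetCard m (Finset.univ : Finset (Fin K))).card := by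
  refine Fintype.card_of_subtype _ fun S => by simp

/-- On average over the hidden sets of the blocks, a strategy selects few hidden arms. -/
theorem card_mul_sum_selectProb_le [Nonempty (MArm K m)]
    {κ : Fin T → (Fin T → MArm K m) → (Fin T → Fin K → Bool) → MArm K m → ℝ}
    (hκ : IsCausalKernel observeCoins κ) (hm : 1 ≤ m) {ε a : ℝ} (h0 : 0 ≤ ε) (hε : ε ≤ 1 / 4)
    (ha : 0 < a) (blk : Fin T → Fin n) (t : Fin T)
    (hL : ε ^ 2 * ((Finset.univ.filter fun s => blk s = blk t).card * m) ≤ a ^ 2 * (K - m)) :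
    K * ∑ σ : Fin n → MArm K m, ∑ j ∈ (σ (blk t)).1,
        selectProb κ ε (fun s => (σ (blk s)).1) t j ≤
      Fintype.card (Fin n → MArm K m) * ((m : ℝ) ^ 2 + 8 * m * K * a) := by
  obtain ⟨m, rfl⟩ : ∃ m', m = m' + 1 := ⟨m - 1, by omega⟩
  set b := blk t with hb
  set B : Finset (Fin T) := Finset.univ.filter fun s => blk s = b with hB
  have hpos : (0 : ℝ) < Fintype.card (MArm K (m + 1)) := by exact_mod_cast Fintype.card_pos
  -- Fix the hidden sets of the other blocks and average only over that of block `b`.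
  have hσ : ∀ σ : Fin n → MArm K (m + 1),
      K * ∑ S : MArm K (m + 1), ∑ j ∈ (Function.update σ b S (blk t)).1,
        selectProb κ ε (fun s => (Function.update σ b S (blk s)).1) t j ≤
      Fintype.card (MArm K (m + 1)) * (((m + 1 : ℕ) : ℝ) ^ 2 + 8 * (m + 1 : ℕ) * K * a) := by
    intro σ
    -- Sets of any size are allowed in block `b`, since the comparison environment has one better
    -- arm fewer there.
    set H : Finset (Fin K) → Fin T → Finset (Fin K) :=
      fun S s => if blk s = b then S else (σ (blk s)).1 with hH
    have hup : ∀ S : MArm K (m + 1),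
        (fun s => (Function.update σ b S (blk s)).1) = H S.1 := by
      intro S
      funext s
      by_cases h : blk s = b
      · simp [hH, h]
      · simp [hH, h]
    have hup' : ∀ S : MArm K (m + 1), Function.update σ b S (blk t) = S := by
      intro S
      rw [← hb, Function.update_self]
    simp_rw [hup, hup']
    rw [sum_mArm (fun S => ∑ j ∈ S, selectProb κ ε (H S) t j), card_mArm]
    have key := card_mul_sum_mass_le m (e := fun S => selectProb κ ε (H S) t)
      (τ := fun V i => 2 * ε ^ 2 / a * ∑ s ∈ B, selectProb κ ε (H V) s i + 2 * a)
      (η := 4 * a) (fun S => sum_selectProb hκ ε _ t) ?_ ?_ (by positivity)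
    · refine (le_of_eq ?_).trans (key.trans (le_of_eq ?_))
      · simp
      · simp only [Fintype.card_fin]
        ring
    · intro V _ i hi j
      refine abs_selectProb_sub_le hκ h0 hε (B := B) ?_ ?_ ?_ ha t j
      · intro s hs
        have : blk s = b := by simpa [hB] using hs
        simpa [hH, this] using hi
      · intro s hs
        have : blk s = b := by simpa [hB] using hs
        simp [hH, this]
      · intro s hs
        have : blk s ≠ b := by simpa [hB] using hs
        simp [hH, this]
    · intro V hV
      -- The exploration budget: each round selects only `m + 1` arms, and the arms outside `V`
      -- share them.
      have hle : ∑ i ∈ Vᶜ, ∑ s ∈ B, selectProb κ ε (H V) s i ≤ B.card * (m + 1 : ℕ) := by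
        rw [Finset.sum_comm, ← nsmul_eq_mul, ← Finset.sum_const]
        refine Finset.sum_le_sum fun s _ => ?_
        rw [← sum_selectProb hκ ε (H V) s]
        refine Finset.sum_le_sum_of_subset_of_nonneg (Finset.subset_univ _) fun i _ _ => ?_
        have := playExp_mono (hiddenWeight_nonneg h0 hε (H V)) hκ (F := fun _ _ => 0)
          (G := fun U _ => if i ∈ (U s).1 then 1 else 0) (fun U x => by split_ifs <;> simp)
        rwa [playExp_const (sum_hiddenWeight ε _) hκ] at this
      have hc : ((K : ℝ) - (m + 1 : ℕ)) ≤ (Vᶜ.card : ℝ) := by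
        rw [Finset.card_compl, hV, Fintype.card_fin]
        have : (K : ℝ) ≤ ((K - m : ℕ) : ℝ) + m := by exact_mod_cast (by omega : K ≤ K - m + m)
        push_cast
        linarith
      rw [Finset.sum_add_distrib, ← Finset.mul_sum, Finset.sum_const, nsmul_eq_mul]
      have h1 : 2 * ε ^ 2 / a * ∑ i ∈ Vᶜ, ∑ s ∈ B, selectProb κ ε (H V) s i ≤
          2 * ε ^ 2 / a * (B.card * (m + 1 : ℕ)) := by gcongr
      have h2 : 2 * ε ^ 2 / a * (B.card * (m + 1 : ℕ)) ≤ 2 * a * Vᶜ.card := by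
        rw [div_mul_eq_mul_div, div_le_iff₀ ha]
        have := mul_le_mul_of_nonneg_left hc (sq_nonneg a)
        nlinarith
      linarith
  have hsum := Finset.sum_le_sum fun (σ : Fin n → MArm K (m + 1)) (_ : σ ∈ Finset.univ) => hσ σ
  rw [← Finset.mul_sum, sum_update b (fun σ : Fin n → MArm K (m + 1) => ∑ j ∈ (σ (blk t)).1,
    selectProb κ ε (fun s => (σ (blk s)).1) t j), Finset.sum_const, nsmul_eq_mul,
    Finset.card_univ] at hsum
  refine le_of_mul_le_mul_left ?_ hpos
  linarith

end Blocks

/-! ### Finitely supported laws -/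

section FiniteLaw

variable {Ω E : Type*} [Fintype Ω] [MeasurableSpace E]

/-- The law of `X` when the points of the finite type `Ω` have the probabilities `p`. -/
noncomputable def finiteLaw (p : Ω → ℝ) (X : Ω → E) : Measure E :=
  ∑ ω, ENNReal.ofReal (p ω) • Measure.dirac (X ω)

theorem isProbabilityMeasure_finiteLaw {p : Ω → ℝ} (h0 : ∀ ω, 0 ≤ p ω) (h1 : ∑ ω, p ω = 1)
    (X : Ω → E) : IsProbabilityMeasure (finiteLaw p X) := by
  constructor
  simp [finiteLaw, ← ENNReal.ofReal_sum_of_nonneg fun ω _ => h0 ω, h1]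

variable [MeasurableSingletonClass E]

theorem ae_finiteLaw {p : Ω → ℝ} {X : Ω → E} {P : E → Prop} (h : ∀ ω, P (X ω)) :
    ∀ᵐ x ∂finiteLaw p X, P x := by
  unfold finiteLaw
  rw [ae_finsetSum_measure_iff]
  intro ω _
  exact Measure.ae_smul_measure (by simpa [ae_dirac_eq] using h ω) _

theorem integral_finiteLaw {p : Ω → ℝ} (h0 : ∀ ω, 0 ≤ p ω) (X : Ω → E) (F : E → ℝ) :
    ∫ x, F x ∂finiteLaw p X = ∑ ω, p ω * F (X ω) := by
  unfold finiteLaw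
  rw [integral_finsetSum_measure]
  · refine Finset.sum_congr rfl fun ω _ => ?_
    rw [integral_smul_measure, integral_dirac, ENNReal.toReal_ofReal (h0 ω), smul_eq_mul]
  · intro ω _
    exact (integrable_dirac (by simp)).smul_measure ENNReal.ofReal_ne_top

end FiniteLaw

/-! ### The block experts and their gains -/

namespace ExpertAdvice

variable {K m T N Nr : ℕ}

theorem bestExpertGain_le_bestCombinationGain (adv : ExpertAdvice K m T N Nr) (x : Gains K T) :
    adv.bestExpertGain x ≤ adv.bestCombinationGain x := by
  have : Nonempty (Fin N) := ⟨⟨0, adv.N_pos⟩⟩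
  refine ciSup_le fun k => ?_
  obtain ⟨A, hA, hsum⟩ := adv.actual_eq k
  have h : ∑ t, ∑ j, adv.actual t k j * x t j = ∑ i ∈ A, adv.underlyingGain x i := by
    simp only [underlyingGain]
    rw [Finset.sum_comm (s := A)]
    refine Finset.sum_congr rfl fun t _ => ?_
    rw [Finset.sum_comm (s := A)]
    refine Finset.sum_congr rfl fun j _ => ?_
    rw [hsum, Finset.sum_mul]
  rw [h]
  exact le_ciSup (f := fun A : {A : Finset (Fin Nr) // A.card = m} =>
    ∑ i ∈ A.1, adv.underlyingGain x i) (Set.finite_range _).bddAbove ⟨A, hA⟩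

variable {n : ℕ}

/-- The advice in which each underlying expert recommends one arm in each block of rounds, and
each actual expert recommends one `m`-set of arms in each block. -/
noncomputable def ofBlocks [Nonempty (MArm K m)] (blk : Fin T → Fin n)
    (hblk : Function.Surjective blk) (hn : 0 < n) :
    ExpertAdvice K m T (Fintype.card (Fin n → MArm K m)) (K ^ n) where
  actual t k j := if j ∈ ((Fintype.equivFin _).symm k (blk t)).1 then 1 else 0
  underlying t i j := if finFunctionFinEquiv.symm i (blk t) = j then 1 else 0
  N_pos := Fintype.card_pos
  actual_nonneg t k j := by split_ifs <;> simp
  actual_le_one t k j := by split_ifs <;> simp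
  actual_sum t k := by
    simp [((Fintype.equivFin (Fin n → MArm K m)).symm k (blk t)).2]
  underlying_nonneg t i j := by split_ifs <;> simp
  underlying_injective i i' h := by
    apply finFunctionFinEquiv.symm.injective
    funext b
    obtain ⟨t, rfl⟩ := hblk b
    have := congrFun (congrFun h t) (finFunctionFinEquiv.symm i' (blk t))
    simpa using this
  actual_eq k := by
    set σ := (Fintype.equivFin (Fin n → MArm K m)).symm k with hσ
    -- Underlying expert `l` takes the `l`-th smallest arm of the recommended set in every block;
    -- these `m` experts already differ in block `0`.
    set f : Fin m → Fin (K ^ n) := fun l =>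
      finFunctionFinEquiv fun b => (σ b).1.orderEmbOfFin (σ b).2 l with hf
    have hinj : Function.Injective f := by
      intro l l' h
      have := congrFun (finFunctionFinEquiv.injective h) ⟨0, hn⟩
      exact ((σ ⟨0, hn⟩).1.orderEmbOfFin (σ ⟨0, hn⟩).2).injective this
    refine ⟨Finset.univ.map ⟨f, hinj⟩, by simp, fun t j => ?_⟩
    simp only [Finset.sum_map, Function.Embedding.coeFn_mk, hf, Equiv.symm_apply_apply]
    have hmap : (σ (blk t)).1 =
        Finset.univ.map ((σ (blk t)).1.orderEmbOfFin (σ (blk t)).2).toEmbedding := by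
      simp
    rw [← Finset.sum_ite_eq' (σ (blk t)).1 j (fun _ => (1 : ℝ))]
    conv_lhs => rw [hmap, Finset.sum_map]
    rfl

theorem le_bestExpertGain_ofBlocks [Nonempty (MArm K m)] (blk : Fin T → Fin n)
    (hblk : Function.Surjective blk) (hn : 0 < n) (x : Gains K T) (σ : Fin n → MArm K m) :
    ∑ t, ∑ j ∈ (σ (blk t)).1, x t j ≤ (ofBlocks (K := K) (m := m) blk hblk hn).bestExpertGain x := by
  refine le_trans (le_of_eq ?_) (le_ciSup (Set.finite_range _).bddAbove
    (Fintype.equivFin (Fin n → MArm K m) σ))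
  simp [ofBlocks]

end ExpertAdvice

/-! ### The regret under the random hidden sets -/

section LowerBound

variable {K m n T N Nr : ℕ}

/-- The selection probabilities of a strategy that plays on rows of coins. -/
noncomputable def coinKernel (alg : Strategy K m T N Nr) (adv : ExpertAdvice K m T N Nr) :
    Fin T → (Fin T → MArm K m) → (Fin T → Fin K → Bool) → MArm K m → ℝ :=
  fun t U x a => (alg t (fun s _ => (adv.actual s, adv.underlying s)) (fun s _ => U s)
    (fun s _ => observeCoins (U s) (x s)) a).toReal

theorem isCausalKernel_coinKernel (alg : Strategy K m T N Nr) (adv : ExpertAdvice K m T N Nr) :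
    IsCausalKernel observeCoins (coinKernel alg adv) where
  nonneg _ _ _ _ := ENNReal.toReal_nonneg
  sum_one t U x := by
    unfold coinKernel
    rw [← ENNReal.toReal_sum fun a _ => PMF.apply_ne_top _ _, ← tsum_fintype (L := .unconditional _),
      PMF.tsum_coe, ENNReal.toReal_one]
  congr t U U' x x' h := by
    have h1 : (fun (s : Fin T) (_ : s < t) => U s) = fun s _ => U' s := by
      funext s hs
      exact (h s hs).1
    have h2 : (fun (s : Fin T) (_ : s < t) => observeCoins (U s) (x s)) =
        fun s _ => observeCoins (U' s) (x' s) := by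
      funext s hs
      exact (h s hs).2
    unfold coinKernel
    rw [h1, h2]

/-- The probability of hidden sets `σ`, drawn uniformly, and a table of coins `x` with the
success probability `1 / 2 + ε` on the hidden sets. -/
noncomputable def blockProb (ε : ℝ) (blk : Fin T → Fin n)
    (ω : (Fin n → MArm K m) × (Fin T → Fin K → Bool)) : ℝ :=
  (Fintype.card (Fin n → MArm K m) : ℝ)⁻¹ *
    ∏ t, hiddenWeight ε (fun s => (ω.1 (blk s)).1) t (ω.2 t)

theorem blockProb_nonneg {ε : ℝ} (h0 : 0 ≤ ε) (hε : ε ≤ 1 / 4) (blk : Fin T → Fin n)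
    (ω : (Fin n → MArm K m) × (Fin T → Fin K → Bool)) : 0 ≤ blockProb ε blk ω :=
  mul_nonneg (by positivity) (Finset.prod_nonneg fun _ _ => hiddenWeight_nonneg h0 hε _ _ _)

theorem sum_blockProb [Nonempty (MArm K m)] (ε : ℝ) (blk : Fin T → Fin n) :
    ∑ ω : (Fin n → MArm K m) × (Fin T → Fin K → Bool), blockProb ε blk ω = 1 := by
  have h : ∀ σ : Fin n → MArm K m, ∑ x : Fin T → Fin K → Bool,
      ∏ t, hiddenWeight ε (fun s => (σ (blk s)).1) t (x t) = 1 := by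
    intro σ
    have h2 := Finset.prod_univ_sum (fun _ : Fin T => (Finset.univ : Finset (Fin K → Bool)))
      (fun t y => hiddenWeight ε (fun s => (σ (blk s)).1) t y)
    rw [Fintype.piFinset_univ] at h2
    rw [← h2]
    exact Finset.prod_eq_one fun t _ => sum_hiddenWeight _ _ _
  simp only [blockProb, Fintype.sum_prod_type, ← Finset.mul_sum, h]
  simp only [Finset.sum_const, Finset.card_univ, nsmul_eq_mul, mul_one]
  exact inv_mul_cancel₀ (by exact_mod_cast Fintype.card_ne_zero)

/-- The law of the gains with uniformly drawn hidden sets. -/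
noncomputable def blockLaw (K m : ℕ) (ε : ℝ) (blk : Fin T → Fin n) : Measure (Gains K T) :=
  finiteLaw (blockProb (m := m) ε blk) fun ω t => coinGain (ω.2 t)

/-- Of the benchmark only `hG` matters, that it dominates every block choice, so both kinds of best
expert are covered at once. Replacing it by the gain of the hidden sets costs nothing in a lower
bound and makes the regret linear in the selection probabilities. -/
theorem le_expectedRegret_blockLaw [Nonempty (MArm K m)] (alg : Strategy K m T N Nr)
    (adv : ExpertAdvice K m T N Nr) {Gmax : Gains K T → ℝ} (hm : 1 ≤ m) (hK : 0 < K)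
    {ε a δ : ℝ} (h0 : 0 ≤ ε) (hε : ε ≤ 1 / 4) (ha : 0 < a) (hδ : (m : ℝ) ≤ (1 - δ) * K)
    (blk : Fin T → Fin n)
    (hL : ∀ b, ε ^ 2 * ((Finset.univ.filter fun s => blk s = b).card * m) ≤ a ^ 2 * (K - m))
    (hG : ∀ (σ : Fin n → MArm K m) x, ∑ t, ∑ j ∈ (σ (blk t)).1, x t j ≤ Gmax x) :
    T * (ε * (m * (δ - 8 * a))) ≤ expectedRegret (blockLaw K m ε blk) alg adv Gmax := by
  set κ := coinKernel alg adv with hκdef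
  have hκ := isCausalKernel_coinKernel alg adv
  set C : ℝ := (Fintype.card (Fin n → MArm K m) : ℝ) with hC
  have hCpos : 0 < C := by
    rw [hC]
    exact_mod_cast Fintype.card_pos
  have hK' : (0 : ℝ) < K := by exact_mod_cast hK
  have h1 : C⁻¹ * ∑ σ : Fin n → MArm K m, playExp (hiddenWeight ε fun s => (σ (blk s)).1) κ
      (fun U x => (∑ t, ∑ j ∈ (σ (blk t)).1, coinGain (x t) j) -
        algGain (fun t => coinGain (x t)) U) ≤
      expectedRegret (blockLaw K m ε blk) alg adv Gmax := by
    unfold expectedRegret blockLaw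
    rw [integral_finiteLaw (blockProb_nonneg h0 hε blk), Fintype.sum_prod_type, Finset.mul_sum]
    refine Finset.sum_le_sum fun σ _ => ?_
    unfold playExp
    rw [Finset.mul_sum]
    refine Finset.sum_le_sum fun x _ => ?_
    rw [blockProb, mul_assoc]
    refine mul_le_mul_of_nonneg_left ?_ (by positivity)
    rw [Finset.mul_sum]
    refine Finset.sum_le_sum fun U _ => ?_
    rw [mul_assoc]
    refine mul_le_mul_of_nonneg_left ?_
      (Finset.prod_nonneg fun _ _ => hiddenWeight_nonneg h0 hε _ _ _)
    refine mul_le_mul_of_nonneg_left (sub_le_sub_right (hG σ _) _)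
      (Finset.prod_nonneg fun _ _ => hκ.nonneg _ _ _ _)
  refine le_trans ?_ h1
  have h2 : ∀ t, C * (m * (δ - 8 * a)) ≤ ∑ σ : Fin n → MArm K m, ((m : ℝ) -
      ∑ j ∈ (σ (blk t)).1, selectProb κ ε (fun s => (σ (blk s)).1) t j) := by
    intro t
    have h3 := card_mul_sum_selectProb_le hκ hm h0 hε ha blk t (hL _)
    rw [Finset.sum_sub_distrib, Finset.sum_const, nsmul_eq_mul, Finset.card_univ, ← hC]
    rw [← hC] at h3
    -- Here `m / K ≤ 1 - δ` enters: blind play misses at least the fraction `δ` of the hidden arms.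
    have h4 : C * ((m : ℝ) ^ 2 + 8 * m * K * a) ≤
        K * (C * (m * ((1 - δ) + 8 * a))) := by
      have : (m : ℝ) * m ≤ m * ((1 - δ) * K) := by gcongr
      have := mul_le_mul_of_nonneg_left this hCpos.le
      linarith
    have h5 := le_of_mul_le_mul_left (h3.trans h4) hK'
    linarith
  have h6 : ∑ σ : Fin n → MArm K m, playExp (hiddenWeight ε fun s => (σ (blk s)).1) κ
      (fun U x => (∑ t, ∑ j ∈ (σ (blk t)).1, coinGain (x t) j) -
        algGain (fun t => coinGain (x t)) U) =
      ∑ t, ε * ∑ σ : Fin n → MArm K m, ((m : ℝ) -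
        ∑ j ∈ (σ (blk t)).1, selectProb κ ε (fun s => (σ (blk s)).1) t j) := by
    simp_rw [Finset.mul_sum]
    rw [Finset.sum_comm]
    refine Finset.sum_congr rfl fun σ _ => ?_
    rw [playExp_hiddenGain_sub_algGain hκ ε (fun s => (σ (blk s)).1) fun t => (σ (blk t)).2]
  rw [h6, inv_mul_eq_div, le_div_iff₀ hCpos]
  calc T * (ε * (m * (δ - 8 * a))) * C
      = ∑ _t : Fin T, ε * (C * (m * (δ - 8 * a))) := by
        rw [Finset.sum_const, Finset.card_univ, Fintype.card_fin, nsmul_eq_mul]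
        ring
    _ ≤ _ := Finset.sum_le_sum fun t _ => mul_le_mul_of_nonneg_left (h2 t) h0

end LowerBound

/-! ### Choice of the parameters -/

theorem mainTheorem4 (δ : ℝ) (hδ : 0 < δ) :
    ∃ c : ℝ, 0 < c ∧
      ∀ K m n T Nr : ℕ, 1 ≤ m → (m : ℝ) ≤ (1 - δ) * K → 1 ≤ n → n ∣ T → K * n ≤ m * T →
        Nr = K ^ n →
        ∃ (N : ℕ) (D : Measure (Gains K T)), IsProbabilityMeasure D ∧
          (∀ᵐ x ∂D, ∀ t i, x t i ∈ Set.Icc (0 : ℝ) 1) ∧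
          ∀ alg : Strategy K m T N Nr, ∃ adv : ExpertAdvice K m T N Nr,
            c * √(m * K * T * Real.log Nr / Real.log K)
                ≤ expectedRegret D alg adv adv.bestExpertGain ∧
            c * √(m * K * T * Real.log Nr / Real.log K)
                ≤ expectedRegret D alg adv adv.bestCombinationGain := by
  refine ⟨δ ^ 2 * √δ / 32, by positivity, ?_⟩
  intro K m n T Nr hm hmK hn hnT hKT hNr
  subst hNr
  obtain ⟨L, rfl⟩ := hnT
  have hm' : (1 : ℝ) ≤ m := by exact_mod_cast hm
  have hK0 : 0 < K := by
    rcases Nat.eq_zero_or_pos K with rfl | h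
    · simp at hmK
      linarith
    · exact h
  have hK0' : (0 : ℝ) < K := by exact_mod_cast hK0
  have hδ1 : δ < 1 := by
    by_contra! h
    nlinarith
  have hmK' : m < K := by
    have : (m : ℝ) < K := by nlinarith
    exact_mod_cast this
  have hL0 : 0 < L := by
    rcases Nat.eq_zero_or_pos L with rfl | h
    · simp at hKT
      omega
    · exact h
  -- The assumption `K * n ≤ m * T`, read per block; it keeps the bias `ε` below `1 / 4`.
  have hKL : K ≤ m * L := by
    refine Nat.le_of_mul_le_mul_right (c := n) ?_ hn
    rw [mul_assoc, mul_comm L n]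
    exact hKT
  have hKL' : (K : ℝ) ≤ m * L := by exact_mod_cast hKL
  have hL0' : (0 : ℝ) < L := by exact_mod_cast hL0
  have hmL : (0 : ℝ) < m * L := by positivity
  have : Nonempty (MArm K m) := by
    obtain ⟨S, -, hS⟩ := Finset.exists_subset_card_eq
      (show m ≤ (Finset.univ : Finset (Fin K)).card by simpa using hmK'.le)
    exact ⟨⟨S, hS⟩⟩
  set blk : Fin (n * L) → Fin n := fun t => (finProdFinEquiv.symm t).1 with hblk
  have hsurj : Function.Surjective blk := fun b =>
    ⟨finProdFinEquiv (b, ⟨0, hL0⟩), by simp only [hblk, Equiv.symm_apply_apply]⟩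
  have hcard : ∀ b, (Finset.univ.filter fun s => blk s = b).card = L := by
    intro b
    have : (Finset.univ.filter fun s => blk s = b) =
        Finset.univ.map ⟨fun l : Fin L => finProdFinEquiv (b, l), fun l l' h => by
          simpa using h⟩ := by
      ext s
      obtain ⟨⟨b', l⟩, rfl⟩ := finProdFinEquiv.surjective s
      simp only [hblk, Equiv.symm_apply_apply, Finset.mem_filter, Finset.mem_univ, true_and,
        Finset.mem_map]
      constructor
      · rintro rfl
        exact ⟨l, rfl⟩
      · rintro ⟨l', h⟩
        exact (congrArg Prod.fst (finProdFinEquiv.injective h)).symm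
    rw [this]
    simp
  -- This makes `δ - 8 * a = δ / 2`. The bias is then chosen so that `ε ^ 2 * L * m = a ^ 2 * δ *
  -- K`, which is within the entropy budget because `δ * K ≤ K - m`. The constant `δ ^ 2 * √δ / 32`
  -- is `δ / 2` times `a * √δ`.
  set a : ℝ := δ / 16 with ha
  set ε : ℝ := a * √(δ * K / (m * L)) with hεdef
  have ha0 : 0 < a := by positivity
  have hε0 : 0 ≤ ε := by positivity
  have hsq : ε ^ 2 = a ^ 2 * (δ * K / (m * L)) := by
    rw [hεdef, mul_pow, Real.sq_sqrt (by positivity)]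
  have hε4 : ε ≤ 1 / 4 := by
    have h1 : δ * K / (m * L) ≤ 1 := by
      rw [div_le_one hmL]
      nlinarith
    have h2 : √(δ * K / (m * L)) ≤ 1 := by
      rwa [Real.sqrt_le_one]
    have : ε ≤ a * 1 := mul_le_mul_of_nonneg_left h2 ha0.le
    linarith
  have hexp : ∀ b, ε ^ 2 * ((Finset.univ.filter fun s => blk s = b).card * m) ≤
      a ^ 2 * (K - m) := by
    intro b
    rw [hcard, hsq]
    have : a ^ 2 * (δ * K / (m * L)) * (L * m) = a ^ 2 * (δ * K) := by
      field_simp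
    rw [this]
    gcongr
    linarith
  have hbound : δ ^ 2 * √δ / 32 *
      √(m * K * (n * L : ℕ) * Real.log (K ^ n : ℕ) / Real.log K) =
      (n * L : ℕ) * (ε * (m * (δ - 8 * a))) := by
    have hlog : Real.log K ≠ 0 := by
      have : (1 : ℝ) < K := by exact_mod_cast (by omega : 1 < K)
      exact (Real.log_pos this).ne'
    have h1 : (m * K * (n * L : ℕ) * Real.log (K ^ n : ℕ) / Real.log K : ℝ) =
        (m * L * n) ^ 2 * (K / (m * L)) := by
      push_cast
      rw [Real.log_pow]
      field_simp
    rw [h1, Real.sqrt_mul (by positivity), Real.sqrt_sq (by positivity), hεdef, mul_div_assoc δ,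
      Real.sqrt_mul hδ.le, ha]
    push_cast
    ring
  refine ⟨Fintype.card (Fin n → MArm K m), blockLaw K m ε blk,
    isProbabilityMeasure_finiteLaw (blockProb_nonneg hε0 hε4 blk) (sum_blockProb ε blk) _,
    ae_finiteLaw fun ω t i => ?_, fun alg => ⟨ExpertAdvice.ofBlocks blk hsurj hn, ?_, ?_⟩⟩
  · unfold coinGain
    split_ifs <;> simp
  · rw [hbound]
    exact le_expectedRegret_blockLaw alg _ hm hK0 hε0 hε4 ha0 hmK blk hexp fun σ x =>
      ExpertAdvice.le_bestExpertGain_ofBlocks blk hsurj hn x σ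
  · rw [hbound]
    exact le_expectedRegret_blockLaw alg _ hm hK0 hε0 hε4 ha0 hmK blk hexp fun σ x =>
      (ExpertAdvice.le_bestExpertGain_ofBlocks blk hsurj hn x σ).trans
        (ExpertAdvice.bestExpertGain_le_bestCombinationGain _ x)
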